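/- Let $\mathcal H$ be an infinite-dimensional separable (real or complex) Hilbert space, let $\{f_j\}_{j=1}^\infty$ be a linearly independent sequence in $\mathcal H$ (every finite subfamily is linearly independent), and let $\{e_j\}_{j=1}^\infty$ be an orthonormal basis of $\ell_2$ (over the same scalar field). Let $T\colon \ell_2\to\mathcal H$ be a bounded linear operator with $T(e_j)=f_j$ for all $j\ge 1$, and let $|T|=(T^*T)^{1/2}$ be the unique positive operator on $\ell_2$ whose square is $T^*T$. Assume that $I-|T|$ is a Hilbert–Schmidt operator on $\ell_2$, and that $$\dim\bigl((\operatorname{Ran} T)^\perp\bigr)<\dim(\operatorname{Ker} T).$$ Then there is no orthonormal basis $\{v_j\}_{j=1}^\infty$ of $\mathcal H$ with $\sum_{j=1}^\infty\|v_j-f_j\|^2<\infty$; that is, $\sum_{j=1}^\infty\|v_j-f_j\|^2=\infty$ for every orthonormal basis $\{v_j\}_{j=1}^\infty$ of $\mathcal H$. -/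

import Mathlib

/-! ### The positive square root of a positive operator on a real or complex Hilbert space -/

section SquareRoot

variable {𝕜 E : Type*} [RCLike 𝕜] [NormedAddCommGroup E] [InnerProductSpace 𝕜 E] [CompleteSpace E]

theorem norm_one_sub_le_of_isPositive {A : E →L[𝕜] E} (hA : A.IsPositive) (h1 : ‖A‖ ≤ 1) :
    ‖1 - A‖ ≤ 1 := by
  refine ContinuousLinearMap.opNorm_le_bound _ zero_le_one fun x => ?_
  have hsym : ∀ x y, inner 𝕜 (A x) y = inner 𝕜 x (A y) := hA.inner_left_eq_inner_right
  have hpos : ∀ x, 0 ≤ RCLike.re (inner 𝕜 (A x) x) := hA.re_inner_nonneg_left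
  have hn : ∀ x, ‖A x‖ ≤ ‖x‖ := fun x =>
    (A.le_opNorm x).trans (mul_le_of_le_one_left (norm_nonneg x) h1)
  have e1 : RCLike.re (inner 𝕜 (A x) (A x)) = ‖A x‖ ^ 2 := inner_self_eq_norm_sq _
  have e2 : RCLike.re (inner 𝕜 x (A x)) = RCLike.re (inner 𝕜 (A x) x) := by rw [hsym]
  have e3 : RCLike.re (inner 𝕜 (A (A x)) (A x)) ≤ ‖A x‖ ^ 2 := by
    refine (RCLike.re_le_norm _).trans ((norm_inner_le_norm _ _).trans ?_)
    nlinarith [hn (A x), norm_nonneg (A x)]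
  have e4 : RCLike.re (inner 𝕜 (A (A x)) x) = ‖A x‖ ^ 2 := by rw [hsym, e1]
  have e5 : RCLike.re (inner 𝕜 (A x - A (A x)) (x - A x)) =
      RCLike.re (inner 𝕜 (A x) x) - ‖A x‖ ^ 2 - ‖A x‖ ^ 2
        + RCLike.re (inner 𝕜 (A (A x)) (A x)) := by
    simp only [inner_sub_left, inner_sub_right, map_sub, e1, e4]
    ring
  have e6 := hpos (x - A x)
  rw [map_sub, e5] at e6
  have e7 : ‖x - A x‖ ^ 2 = ‖x‖ ^ 2 - 2 * RCLike.re (inner 𝕜 (A x) x) + ‖A x‖ ^ 2 := by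
    rw [@norm_sub_sq 𝕜, e2]
  have e8 : ‖x - A x‖ ^ 2 ≤ ‖x‖ ^ 2 := by nlinarith [sq_nonneg ‖A x‖]
  simpa using (sq_le_sq₀ (norm_nonneg _) (norm_nonneg _)).1 e8

/-- Solution of `Y = (B + Y ^ 2) / 2` by iteration, for a self-adjoint contraction `B`. -/
theorem exists_sqrt_aux {B : E →L[𝕜] E} (hB : IsSelfAdjoint B) (hB1 : ‖B‖ ≤ 1) :
    ∃ Y : E →L[𝕜] E, IsSelfAdjoint Y ∧ ‖Y‖ ≤ 1 ∧ (1 - Y) * (1 - Y) = 1 - B ∧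
      ∀ C : E →L[𝕜] E, Commute C B → Commute C Y := by
  let y : ℕ → (E →L[𝕜] E) := fun n => Nat.rec 0 (fun _ Y => (2⁻¹ : 𝕜) • (B + Y * Y)) n
  let s : ℕ → ℝ := fun n => Nat.rec 0 (fun _ r => 2⁻¹ * (1 + r * r)) n
  have y0 : y 0 = 0 := rfl
  have s0 : s 0 = 0 := rfl
  have ys : ∀ n, y (n + 1) = (2⁻¹ : 𝕜) • (B + y n * y n) := fun n => rfl
  have ss : ∀ n, s (n + 1) = 2⁻¹ * (1 + s n * s n) := fun n => rfl
  have two : ‖(2⁻¹ : 𝕜)‖ = 2⁻¹ := by simp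
  have s_pos : ∀ n, 0 ≤ s n := by
    intro n
    cases n with
    | zero => exact le_of_eq s0.symm
    | succ n => rw [ss]; nlinarith [mul_self_nonneg (s n)]
  have s_le : ∀ n, s n ≤ 1 := by
    intro n
    induction n with
    | zero => rw [s0]; exact zero_le_one
    | succ n ih => rw [ss]; nlinarith [s_pos n]
  have y_le : ∀ n, ‖y n‖ ≤ s n := by
    intro n
    induction n with
    | zero => simp [y0, s0]
    | succ n ih =>
      rw [ys, ss, norm_smul, two]
      have h1 := norm_add_le B (y n * y n)
      have h2 := norm_mul_le (y n) (y n)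
      have h3 := mul_self_le_mul_self (norm_nonneg (y n)) ih
      linarith
  have y_diff : ∀ n, ‖y (n + 1) - y n‖ ≤ s (n + 1) - s n := by
    intro n
    induction n with
    | zero =>
      rw [ys, ss, y0, s0]
      simp only [mul_zero, add_zero, sub_zero, norm_smul, two]
      linarith
    | succ n ih =>
      have e : y (n + 1 + 1) - y (n + 1) =
          (2⁻¹ : 𝕜) • (y (n + 1) * (y (n + 1) - y n) + (y (n + 1) - y n) * y n) := by
        rw [ys (n + 1), ys n, ← smul_sub, ← ys n]
        congr 1
        noncomm_ring
      have e' : s (n + 1 + 1) - s (n + 1) =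
          2⁻¹ * (s (n + 1) * (s (n + 1) - s n) + (s (n + 1) - s n) * s n) := by
        rw [ss (n + 1), ss n, ← mul_sub, ← ss n]
        ring
      rw [e, e', norm_smul, two]
      have h0 := norm_add_le (y (n + 1) * (y (n + 1) - y n)) ((y (n + 1) - y n) * y n)
      have h1 := (norm_mul_le (y (n + 1)) (y (n + 1) - y n)).trans
        (mul_le_mul (y_le (n + 1)) ih (norm_nonneg _) (s_pos (n + 1)))
      have h2 := (norm_mul_le (y (n + 1) - y n) (y n)).trans
        (mul_le_mul ih (y_le n) (norm_nonneg _) ((norm_nonneg _).trans ih))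
      linarith
  have hsum : Summable fun n => s (n + 1) - s n := by
    refine summable_of_sum_range_le (c := 1) (fun n => (norm_nonneg _).trans (y_diff n)) fun n => ?_
    rw [Finset.sum_range_sub, s0, sub_zero]
    exact s_le n
  have hC : CauchySeq y := cauchySeq_of_dist_le_of_summable _
    (fun n => by rw [dist_comm, dist_eq_norm]; exact y_diff n) hsum
  obtain ⟨Y, hY⟩ := cauchySeq_tendsto_of_complete hC
  have y_sa : ∀ n, IsSelfAdjoint (y n) := by
    intro n
    induction n with
    | zero => rw [y0]; exact IsSelfAdjoint.zero _
    | succ n ih =>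
      rw [ys]
      refine IsSelfAdjoint.smul ?_ (hB.add ?_)
      · simp [IsSelfAdjoint]
      · simpa [sq] using ih.pow 2
  have hlim : Y = (2⁻¹ : 𝕜) • (B + Y * Y) := by
    refine tendsto_nhds_unique ((Filter.tendsto_add_atTop_iff_nat 1).2 hY) ?_
    simp only [ys]
    exact ((hY.mul hY).const_add B).const_smul _
  refine ⟨Y, ?_, ?_, ?_, ?_⟩
  · refine tendsto_nhds_unique (hY.star) ?_
    simpa only [(y_sa _).star_eq] using hY
  · exact le_of_tendsto hY.norm (Filter.Eventually.of_forall fun n => (y_le n).trans (s_le n))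
  · have h2 : Y + Y = B + Y * Y := by
      rw [← two_smul 𝕜 Y]
      nth_rw 1 [hlim]
      rw [smul_smul, mul_inv_cancel₀ two_ne_zero, one_smul]
    have h3 : (1 - Y) * (1 - Y) = 1 - (Y + Y) + Y * Y := by noncomm_ring
    rw [h3, h2]
    abel
  · intro C hCB
    have y_comm : ∀ n, Commute C (y n) := by
      intro n
      induction n with
      | zero => rw [y0]; exact Commute.zero_right C
      | succ n ih => rw [ys]; exact (hCB.add_right (ih.mul_right ih)).smul_right _
    refine tendsto_nhds_unique (hY.const_mul C) ?_
    simp only [fun n => (y_comm n).eq]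
    exact hY.mul_const C

theorem exists_positive_sqrt {A : E →L[𝕜] E} (hA : A.IsPositive) :
    ∃ P : E →L[𝕜] E, (P.IsPositive ∧ P * P = A) ∧
      ∀ C : E →L[𝕜] E, Commute C A → Commute C P := by
  set r : ℝ := ‖A‖ + 1 with hr
  have hr0 : 0 < r := by positivity
  have hpos : (((r⁻¹ : ℝ) : 𝕜) • A).IsPositive :=
    hA.smul_of_nonneg (by rw [RCLike.ofReal_nonneg]; positivity)
  have hle : ‖((r⁻¹ : ℝ) : 𝕜) • A‖ ≤ 1 := by
    rw [norm_smul, RCLike.norm_ofReal, abs_of_pos (by positivity), inv_mul_le_iff₀ hr0]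
    linarith
  have hid : IsSelfAdjoint (1 : E →L[𝕜] E) := IsSelfAdjoint.one _
  obtain ⟨Y, hYs, hY1, hYq, hYc⟩ := exists_sqrt_aux (hid.sub hpos.isSelfAdjoint)
    (norm_one_sub_le_of_isPositive hpos hle)
  rw [sub_sub_cancel] at hYq
  refine ⟨((√r : ℝ) : 𝕜) • (1 - Y), ⟨?_, ?_⟩, ?_⟩
  · refine ContinuousLinearMap.IsPositive.smul_of_nonneg ?_
      (by rw [RCLike.ofReal_nonneg]; positivity)
    rw [ContinuousLinearMap.isPositive_def']
    refine ⟨hid.sub hYs, fun x => ?_⟩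
    rw [ContinuousLinearMap.reApplyInnerSelf_apply]
    simp only [sub_apply, one_apply_eq_self, inner_sub_left,
      map_sub, inner_self_eq_norm_sq]
    have h1 : RCLike.re (inner 𝕜 (Y x) x) ≤ ‖Y x‖ * ‖x‖ :=
      (RCLike.re_le_norm _).trans (norm_inner_le_norm _ _)
    have h2 : ‖Y x‖ ≤ ‖x‖ := (Y.le_opNorm x).trans (mul_le_of_le_one_left (norm_nonneg x) hY1)
    nlinarith [norm_nonneg x]
  · rw [smul_mul_smul_comm, hYq, smul_smul, ← RCLike.ofReal_mul, Real.mul_self_sqrt hr0.le,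
      ← RCLike.ofReal_mul, mul_inv_cancel₀ hr0.ne', RCLike.ofReal_one, one_smul]
  · intro C hC
    refine Commute.smul_right (Commute.sub_right (Commute.one_right C) (hYc C ?_)) _
    exact (Commute.one_right C).sub_right (hC.smul_right _)

theorem existsUnique_positive_sqrt {A : E →L[𝕜] E} (hA : A.IsPositive) :
    ∃! P : E →L[𝕜] E, P.IsPositive ∧ P * P = A := by
  obtain ⟨P, hP, hc⟩ := exists_positive_sqrt hA
  refine ⟨P, hP, fun Q hQ => ?_⟩
  have hQA : Commute Q A := by rw [← hQ.2]; exact (Commute.refl Q).mul_right (Commute.refl Q)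
  have hPQ : Q * P = P * Q := hc Q hQA
  have hzero : (Q + P) * (Q - P) = 0 := by
    have : (Q + P) * (Q - P) = Q * Q - P * P - (Q * P - P * Q) := by noncomm_ring
    rw [this, hPQ, hP.2, hQ.2]
    simp
  ext x
  -- with `z = (Q - P) x` one has `(Q + P) z = 0`, hence `Q z = P z = 0`
  set z : E := (Q - P) x with hz
  have hz0 : Q z + P z = 0 := by simpa [hz] using congrArg (fun R : E →L[𝕜] E => R x) hzero
  have hsq : ∀ {R : E →L[𝕜] E}, R.IsPositive → RCLike.re (inner 𝕜 (R z) z) = 0 → R z = 0 := by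
    intro R hR h
    obtain ⟨S, hS, -⟩ := exists_positive_sqrt hR
    have h1 : inner 𝕜 (R z) z = inner 𝕜 (S z) (S z) := by
      rw [← hS.2]
      exact hS.1.inner_left_eq_inner_right (S z) z
    rw [h1, inner_self_eq_norm_sq] at h
    have h2 : S z = 0 := by simpa using h
    rw [← hS.2, mul_apply_eq_comp, h2, map_zero]
  have hsum : RCLike.re (inner 𝕜 (Q z) z) + RCLike.re (inner 𝕜 (P z) z) = 0 := by
    rw [← map_add, ← inner_add_left, hz0, inner_zero_left, map_zero]
  have hQ0 := hQ.1.re_inner_nonneg_left z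
  have hP0 := hP.1.re_inner_nonneg_left z
  have hQz : Q z = 0 := hsq hQ.1 (by linarith)
  have hPz : P z = 0 := hsq hP.1 (by linarith)
  have hnorm : inner 𝕜 z z = 0 := by
    nth_rw 1 [hz]
    rw [sub_apply, inner_sub_left, hQ.1.inner_left_eq_inner_right,
      hP.1.inner_left_eq_inner_right, hQz, hPz]
    simp
  have := inner_self_eq_zero.1 hnorm
  rw [hz, sub_apply] at this
  exact sub_eq_zero.1 this

end SquareRoot

/-! ### The modulus of a bounded operator between Hilbert spaces, Hilbert–Schmidt operators -/

section Operators

variable {𝕜 E F : Type*} [RCLike 𝕜] [NormedAddCommGroup E] [InnerProductSpace 𝕜 E]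
  [CompleteSpace E] [NormedAddCommGroup F] [InnerProductSpace 𝕜 F] [CompleteSpace F]

/-- The modulus `|T| = (T* T)^{1/2}` of a bounded operator `T`: the unique positive operator whose
square is `T* T`. -/
noncomputable def opAbs (T : E →L[𝕜] F) : E →L[𝕜] E :=
  (existsUnique_positive_sqrt (ContinuousLinearMap.isPositive_adjoint_comp_self T)).choose

theorem opAbs_isPositive (T : E →L[𝕜] F) : (opAbs T).IsPositive :=
  (existsUnique_positive_sqrt
    (ContinuousLinearMap.isPositive_adjoint_comp_self T)).choose_spec.1.1

theorem opAbs_mul_self (T : E →L[𝕜] F) :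
    opAbs T * opAbs T = (ContinuousLinearMap.adjoint T).comp T :=
  (existsUnique_positive_sqrt
    (ContinuousLinearMap.isPositive_adjoint_comp_self T)).choose_spec.1.2

theorem eq_opAbs {T : E →L[𝕜] F} {P : E →L[𝕜] E} (hP : P.IsPositive)
    (h : P * P = (ContinuousLinearMap.adjoint T).comp T) : P = opAbs T :=
  (existsUnique_positive_sqrt
    (ContinuousLinearMap.isPositive_adjoint_comp_self T)).choose_spec.2 P ⟨hP, h⟩

/-- On a complex Hilbert space `opAbs` is the absolute value of the continuous functional
calculus. -/
theorem opAbs_eq_cfcAbs {G : Type*} [NormedAddCommGroup G] [InnerProductSpace ℂ G]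
    [CompleteSpace G] (T : G →L[ℂ] G) : opAbs T = CFC.abs T :=
  (eq_opAbs ((ContinuousLinearMap.nonneg_iff_isPositive _).1 (CFC.abs_nonneg T))
    (CFC.abs_mul_abs T)).symm

/-- A bounded operator `A` is Hilbert–Schmidt if `∑ ‖A bᵢ‖² < ∞` for some orthonormal (Hilbert)
basis `b` of its domain; the value of the sum does not depend on the basis. -/
def IsHilbertSchmidt (A : E →L[𝕜] F) : Prop :=
  ∃ (ι : Set E) (b : HilbertBasis ι 𝕜 E), Summable fun i => ‖A (b i)‖ ^ 2

end Operators

universe u v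

/-! Suppose an orthonormal basis `v` were square-summably close to `f`. Let `U` be the unitary with
`U (e j) = v j` and put `S = U⁻¹ T`. Then `‖(1 - S) (e j)‖ = ‖v j - f j‖`, so `1 - S` is
Hilbert–Schmidt and `S` is a compact perturbation of the identity. One half of the Fredholm
alternative, `rank_ker_one_sub_le_of_summable`, bounds the dimension of `ker S` by that of `(ran
S)ᗮ`; carrying this over to `T` by `U` contradicts `hdim`. The alternative itself is reduced to
rank–nullity on a finite-dimensional subspace, since a tail of the Hilbert–Schmidt sum is less than
1. -/

section Fredholm

variable {𝕜 E : Type*} [RCLike 𝕜] [NormedAddCommGroup E] [InnerProductSpace 𝕜 E]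

/-- If `C (1 - K) = 1 - G P` with `C` injective adjoint and `P` the orthogonal projection onto a
finite-dimensional subspace, then the kernel of `1 - K` is no larger than the orthogonal complement
of its range. -/
theorem rank_ker_le_rank_orthogonal_range_of_finite_rank_factor [CompleteSpace E]
    (V : Submodule 𝕜 E) [FiniteDimensional 𝕜 V] {A C G : E →L[𝕜] E}
    (hC : Function.Injective (ContinuousLinearMap.adjoint C))
    (h : ∀ x, C (A x) = x - G (V.starProjection x)) :
    Module.rank 𝕜 (LinearMap.ker (A : E →ₗ[𝕜] E)) ≤
      Module.rank 𝕜 (LinearMap.range (A : E →ₗ[𝕜] E))ᗮ := by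
  let Q : E →ₗ[𝕜] V := (V.orthogonalProjectionOnto : E →ₗ[𝕜] V)
  -- The compression of `1 - G` to `V`: both sides of the inequality are compared with this square
  -- finite-dimensional system.
  let M : V →ₗ[𝕜] V := LinearMap.id - Q ∘ₗ (G : E →ₗ[𝕜] E) ∘ₗ V.subtype
  have hQ : ∀ x, ((Q x : V) : E) = V.starProjection x := fun x => rfl
  have hM : ∀ w : V, M w = w - Q (G w) := fun w => rfl
  have hker : ∀ x ∈ LinearMap.ker (A : E →ₗ[𝕜] E), x = G (Q x) := by
    intro x hx
    have hx' : A x = 0 := hx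
    have := h x
    rw [hx', map_zero] at this
    rw [hQ]
    exact (sub_eq_zero.1 this.symm)
  -- A vector `x` of the kernel satisfies `x = G (Q x)`, so `Q` is injective there.
  have h1 : Module.rank 𝕜 (LinearMap.ker (A : E →ₗ[𝕜] E)) ≤ Module.rank 𝕜 (LinearMap.ker M) := by
    refine LinearMap.rank_le_of_injective (Q.restrict (fun x hx => ?_)) fun x y hxy => ?_
    · rw [LinearMap.mem_ker, hM, ← hker x hx, sub_self]
    · have hxy' : Q x = Q y := congrArg Subtype.val hxy
      exact Subtype.ext (by rw [hker x x.2, hker y y.2, hxy'])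
  have h2 : Module.rank 𝕜 (LinearMap.ker M) = Module.rank 𝕜 (LinearMap.range M)ᗮ := by
    rw [← Module.finrank_eq_rank, ← Module.finrank_eq_rank]
    have a := LinearMap.finrank_range_add_finrank_ker M
    have b := Submodule.finrank_add_finrank_orthogonal (LinearMap.range M)
    congr 1
    omega
  -- For `v` in `V`, `⟪A x, C* v⟫ = ⟪C (A x), v⟫ = ⟪M (Q x), v⟫`, so `C*` embeds one complement in
  -- the other.
  have h3 : Module.rank 𝕜 (LinearMap.range M)ᗮ ≤
      Module.rank 𝕜 (LinearMap.range (A : E →ₗ[𝕜] E))ᗮ := by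
    refine LinearMap.rank_le_of_injective
      (((ContinuousLinearMap.adjoint C : E →L[𝕜] E) ∘ₗ V.subtype).restrict (fun v hv => ?_))
      fun x y hxy => ?_
    · rw [Submodule.mem_orthogonal] at hv ⊢
      rintro _ ⟨x, rfl⟩
      have hv' := hv _ ⟨Q x, rfl⟩
      rw [hM, Submodule.coe_inner, Submodule.coe_sub, hQ, hQ, inner_sub_left,
        Submodule.inner_starProjection_left_eq_right, Submodule.inner_starProjection_left_eq_right,
        Submodule.starProjection_eq_self_iff.2 v.2] at hv'
      change inner 𝕜 (A x) (ContinuousLinearMap.adjoint C (v : E)) = 0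
      rw [ContinuousLinearMap.adjoint_inner_right, h, inner_sub_left, hv']
    · exact Subtype.ext (Subtype.ext (hC (congrArg Subtype.val hxy)))
  exact h1.trans (h2.le.trans h3)

/-- Half of the Fredholm alternative for `1 - K`, where `K` is a strict contraction up to a
finite-rank perturbation. -/
theorem rank_ker_one_sub_le_rank_orthogonal_range [CompleteSpace E]
    (V : Submodule 𝕜 E) [FiniteDimensional 𝕜 V] {K : E →L[𝕜] E}
    (hK : ‖K * (1 - V.starProjection)‖ < 1) :
    Module.rank 𝕜 (LinearMap.ker ((1 - K : E →L[𝕜] E) : E →ₗ[𝕜] E)) ≤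
      Module.rank 𝕜 (LinearMap.range ((1 - K : E →L[𝕜] E) : E →ₗ[𝕜] E))ᗮ := by
  -- With `P` the projection onto `V`, `B = 1 - K (1 - P)` is invertible by a Neumann series, and `1
  -- - K = B - K P`; multiply by `B⁻¹`.
  obtain ⟨B, hB⟩ := isUnit_one_sub_of_norm_lt_one hK
  have hBC : (B : E →L[𝕜] E) * (↑B⁻¹ : E →L[𝕜] E) = 1 := B.mul_inv
  have hCB : (↑B⁻¹ : E →L[𝕜] E) * (B : E →L[𝕜] E) = 1 := B.inv_mul
  refine rank_ker_le_rank_orthogonal_range_of_finite_rank_factor V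
    (C := (↑B⁻¹ : E →L[𝕜] E)) (G := (↑B⁻¹ : E →L[𝕜] E) * K) ?_ ?_
  · have hadj : star (B : E →L[𝕜] E) * star (↑B⁻¹ : E →L[𝕜] E) = 1 := by
      rw [← star_mul, hCB, star_one]
    exact Function.LeftInverse.injective (g := ⇑(star (B : E →L[𝕜] E))) fun x =>
      congrArg (fun R : E →L[𝕜] E => R x) hadj
  · intro x
    have key : (↑B⁻¹ : E →L[𝕜] E) * (1 - K) = 1 - ↑B⁻¹ * K * V.starProjection := by
      have : (1 - K : E →L[𝕜] E) = B - K * V.starProjection := by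
        rw [hB]; noncomm_ring
      rw [this, mul_sub, hCB, mul_assoc]
    exact congrArg (fun R : E →L[𝕜] E => R x) key

/-- Expand `x` in the basis, where only indices from `N` on survive, then apply Cauchy–Schwarz and
Bessel to the finite partial sums. -/
theorem HilbertBasis.norm_map_le_of_tail {F : Type*} [NormedAddCommGroup F] [NormedSpace 𝕜 F]
    (e : HilbertBasis ℕ 𝕜 E) (D : E →L[𝕜] F) (N : ℕ)
    (hD : Summable fun j => ‖D (e j)‖ ^ 2) {x : E} (hx : ∀ j < N, inner 𝕜 (e j) x = 0) :
    ‖D x‖ ≤ √(∑' j, ‖D (e (j + N))‖ ^ 2) * ‖x‖ := by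
  have hs : HasSum (fun j => inner 𝕜 (e j) x • D (e j)) (D x) := by
    simpa [HilbertBasis.repr_apply_apply] using D.hasSum (e.hasSum_repr x)
  have hzero : ∑ j ∈ Finset.range N, inner 𝕜 (e j) x • D (e j) = 0 :=
    Finset.sum_eq_zero fun j hj => by rw [hx j (Finset.mem_range.1 hj), zero_smul]
  have hs' : HasSum (fun j => inner 𝕜 (e (j + N)) x • D (e (j + N))) (D x) := by
    have := (hasSum_nat_add_iff' N).2 hs
    rwa [hzero, sub_zero] at this
  have hDN : Summable fun j => ‖D (e (j + N))‖ ^ 2 := (summable_nat_add_iff N).2 hD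
  refine le_of_tendsto hs'.norm (Filter.Eventually.of_forall fun s => ?_)
  have hb : ∑ j ∈ s, ‖inner 𝕜 (e (j + N)) x‖ ^ 2 ≤ ‖x‖ ^ 2 :=
    (e.orthonormal.comp (fun j => j + N) (add_left_injective N)).sum_inner_products_le x
  calc ‖∑ j ∈ s, inner 𝕜 (e (j + N)) x • D (e (j + N))‖
      ≤ ∑ j ∈ s, ‖inner 𝕜 (e (j + N)) x‖ * ‖D (e (j + N))‖ :=
        (norm_sum_le _ _).trans_eq (Finset.sum_congr rfl fun j _ => norm_smul _ _)
    _ ≤ √(∑ j ∈ s, ‖inner 𝕜 (e (j + N)) x‖ ^ 2) * √(∑ j ∈ s, ‖D (e (j + N))‖ ^ 2) :=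
        Real.sum_mul_le_sqrt_mul_sqrt _ _ _
    _ ≤ ‖x‖ * √(∑' j, ‖D (e (j + N))‖ ^ 2) := by
        gcongr
        · exact (Real.sqrt_le_sqrt hb).trans_eq (Real.sqrt_sq (norm_nonneg x))
        · exact hDN.sum_le_tsum _ fun j _ => sq_nonneg _
    _ = _ := mul_comm _ _

/-- A Hilbert–Schmidt perturbation of the identity has kernel no larger than the orthogonal
complement of its range. -/
theorem rank_ker_one_sub_le_of_summable [CompleteSpace E] (e : HilbertBasis ℕ 𝕜 E)
    {K : E →L[𝕜] E} (hK : Summable fun j => ‖K (e j)‖ ^ 2) :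
    Module.rank 𝕜 (LinearMap.ker ((1 - K : E →L[𝕜] E) : E →ₗ[𝕜] E)) ≤
      Module.rank 𝕜 (LinearMap.range ((1 - K : E →L[𝕜] E) : E →ₗ[𝕜] E))ᗮ := by
  -- Past `N` the tail sum is below 1, which makes `K` a strict contraction on the complement of the
  -- span of the first `N` basis vectors.
  obtain ⟨N, hN⟩ := ((tendsto_sum_nat_add fun j => ‖K (e j)‖ ^ 2).eventually_lt_const
    zero_lt_one).exists
  let V : Submodule 𝕜 E := Submodule.span 𝕜 (e '' Set.Iio N)
  have : FiniteDimensional 𝕜 V :=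
    FiniteDimensional.span_of_finite 𝕜 ((Set.finite_Iio N).image e)
  have hc : √(∑' j, ‖K (e (j + N))‖ ^ 2) < 1 := by
    rw [Real.sqrt_lt' one_pos, one_pow]; exact hN
  refine rank_ker_one_sub_le_rank_orthogonal_range V (lt_of_le_of_lt ?_ hc)
  refine ContinuousLinearMap.opNorm_le_bound _ (Real.sqrt_nonneg _) fun x => ?_
  have hmem : x - V.starProjection x ∈ Vᗮ := Submodule.sub_starProjection_mem_orthogonal x
  refine (e.norm_map_le_of_tail K N hK (x := x - V.starProjection x) fun j hj => ?_).trans ?_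
  · exact hmem _ (Submodule.subset_span ⟨j, hj, rfl⟩)
  · gcongr
    rw [← Submodule.starProjection_orthogonal_val]
    exact Submodule.norm_starProjection_apply_le _ x

end Fredholm

theorem mainTheorem6 {𝕜 : Type u} {H : Type v} [RCLike 𝕜] [NormedAddCommGroup H]
    [InnerProductSpace 𝕜 H] [CompleteSpace H] [TopologicalSpace.SeparableSpace H]
    (hH : ¬ FiniteDimensional 𝕜 H)
    (f : ℕ → H) (hf : LinearIndependent 𝕜 f)
    (e : HilbertBasis ℕ 𝕜 (lp (fun _ : ℕ => 𝕜) 2))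
    (T : lp (fun _ : ℕ => 𝕜) 2 →L[𝕜] H) (hT : ∀ j, T (e j) = f j)
    (hHS : IsHilbertSchmidt (1 - opAbs T))
    (hdim : Cardinal.lift.{u} (Module.rank 𝕜 (LinearMap.range (T : lp (fun _ : ℕ => 𝕜) 2 →ₗ[𝕜] H))ᗮ)
      < Cardinal.lift.{v} (Module.rank 𝕜 (LinearMap.ker (T : lp (fun _ : ℕ => 𝕜) 2 →ₗ[𝕜] H)))) :
    ∀ v : HilbertBasis ℕ 𝕜 H, ¬ Summable (fun j => ‖v j - f j‖ ^ 2) := by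
  intro v hv
  let U : lp (fun _ : ℕ => 𝕜) 2 ≃ₗᵢ[𝕜] H := e.repr.trans v.repr.symm
  have hU : ∀ j, U (e j) = v j := fun j => by
    change v.repr.symm (e.repr (e j)) = v j
    rw [e.repr_self, v.repr_symm_single]
  let S : lp (fun _ : ℕ => 𝕜) 2 →L[𝕜] lp (fun _ : ℕ => 𝕜) 2 :=
    (U.symm.toContinuousLinearEquiv : H →L[𝕜] lp (fun _ : ℕ => 𝕜) 2).comp T
  have hS : ∀ x, S x = U.symm (T x) := fun x => rfl
  have hK : ∀ j, ‖(1 - S) (e j)‖ = ‖v j - f j‖ := by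
    intro j
    rw [← hT, ← hU, ← U.norm_map ((1 - S) (e j)), sub_apply, map_sub, hS,
      U.apply_symm_apply]
    rfl
  have hsum : Summable fun j => ‖(1 - S) (e j)‖ ^ 2 := by simpa only [hK] using hv
  have h := rank_ker_one_sub_le_of_summable e hsum
  rw [sub_sub_cancel] at h
  have hker : LinearMap.ker (T : lp (fun _ : ℕ => 𝕜) 2 →ₗ[𝕜] H) ≤
      LinearMap.ker (S : lp (fun _ : ℕ => 𝕜) 2 →ₗ[𝕜] lp (fun _ : ℕ => 𝕜) 2) := by
    intro x hx
    have hx' : T x = 0 := hx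
    change S x = 0
    rw [hS, hx', map_zero]
  -- Since `U` is unitary and `U S = T`, it maps `(ran S)ᗮ` into `(ran T)ᗮ`.
  have hran := LinearMap.lift_rank_le_of_injective
    ((U.toLinearEquiv : lp (fun _ : ℕ => 𝕜) 2 →ₗ[𝕜] H).restrict
      (p := (LinearMap.range (S : lp (fun _ : ℕ => 𝕜) 2 →ₗ[𝕜] lp (fun _ : ℕ => 𝕜) 2))ᗮ)
      (q := (LinearMap.range (T : lp (fun _ : ℕ => 𝕜) 2 →ₗ[𝕜] H))ᗮ) (by
        intro y hy
        rw [Submodule.mem_orthogonal] at hy ⊢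
        rintro _ ⟨x, rfl⟩
        have hyx : inner 𝕜 (S x) y = 0 := hy _ ⟨x, rfl⟩
        rw [hS, ← U.inner_map_map, U.apply_symm_apply] at hyx
        exact hyx))
    fun x y hxy => Subtype.ext (U.injective (congrArg Subtype.val hxy))
  exact absurd hdim (not_lt.2
    ((Cardinal.lift_le.2 ((Submodule.rank_mono hker).trans h)).trans hran))
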